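/- Let $L,R,\alpha,\beta>0$ and $0<d<\pi/2$ be constants, and let $\mathscr{D}_d=\{\zeta\in\mathbb{C}:|\operatorname{Im}\zeta|<d\}$. Let $F$ be analytic in $\mathscr{D}_d$ with \[ |F(\zeta)|\le\frac{L}{|1+e^{-\pi\sinh\zeta}|^{\alpha}\,|1+e^{\pi\sinh\zeta}|^{\beta}}\quad(\zeta\in\mathscr{D}_d),\qquad |F(x)|\le\frac{R}{(1+e^{-\pi\sinh x})^{\alpha}(1+e^{\pi\sinh x})^{\beta}}\quad(x\in\mathbb{R}). \] Let $\mu=\min\{\alpha,\beta\}$, let $n$ be a positive integer, and put \[ h=\frac1n,\qquad M=\left\lceil\frac1h\operatorname{arsinh}\left(\frac{dn}{\alpha}\right)\right\rceil,\qquad N=\left\lceil\frac1h\operatorname{arsinh}\left(\frac{dn}{\beta}\right)\right\rceil . \] Then, with $\operatorname{sinc}x=\sin(\pi x)/(\pi x)$ for $x\ne0$ and $\operatorname{sinc}0=1$, \[ \sup_{x\in\mathbb{R}}\left|F(x)-\sum_{k=-M}^{N}F(kh)\operatorname{sinc}\left(\frac{x-kh}{h}\right)\right|\le C\,e^{-\pi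 d n}, \] where $C$ is independent of $n$ and is given by \[ C=\frac{2}{\pi d}\left[\frac{2L}{\pi\mu\,(1-e^{-2\pi d})\cos^{\alpha+\beta}\left(\frac{\pi}{2}\sin d\right)\cos d}+R\right]. \] -/

import Mathlib

namespace DESinc

/-- The strip `{ζ ∈ ℂ : |Im ζ| < d}`. -/
def strip (d : ℝ) : Set ℂ := {ζ : ℂ | |ζ.im| < d}

/-- The normalized sinc function `sin (π x) / (π x)`, with value `1` at `x = 0`
(`Real.sinc` is the unnormalized one). -/
noncomputable def nsinc (x : ℝ) : ℝ := Real.sinc (Real.pi * x)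

/-- The family of functions `F` that are analytic in the strip `strip d`, are bounded there by
`L / (|1 + exp (-π sinh ζ)| ^ α * |1 + exp (π sinh ζ)| ^ β)`, and are bounded on the real line by
`R / ((1 + exp (-π sinh x)) ^ α * (1 + exp (π sinh x)) ^ β)`.
The values of `F` outside the strip are irrelevant. -/
structure MemLDE (L R α β d : ℝ) (F : ℂ → ℂ) : Prop where
  analytic : AnalyticOnNhd ℂ F (strip d)
  bound_strip : ∀ ζ ∈ strip d,
    ‖F ζ‖ ≤ L / (‖1 + Complex.exp (-(Real.pi * Complex.sinh ζ))‖ ^ α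
      * ‖1 + Complex.exp (Real.pi * Complex.sinh ζ)‖ ^ β)
  bound_real : ∀ x : ℝ,
    ‖F (x : ℂ)‖ ≤ R / ((1 + Real.exp (-(Real.pi * Real.sinh x))) ^ α
      * (1 + Real.exp (Real.pi * Real.sinh x)) ^ β)

/-- The truncated Sinc approximation `∑_{k=-M}^{N} F(kh) sinc((x - kh)/h)`. -/
noncomputable def sincApprox (F : ℂ → ℂ) (h : ℝ) (M N : ℤ) (x : ℝ) : ℂ :=
  ∑ k ∈ Finset.Icc (-M) N,
    F (((k : ℝ) * h : ℝ) : ℂ) * ((nsinc ((x - (k : ℝ) * h) / h) : ℝ) : ℂ)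

end DESinc

/-! The error is the discretization error of the infinite sinc series plus the truncation error of
its tails; both are of order exp(-πdn).

Discretization: integrate `sincKernel` around [-(K+1/2)h, (K+1/2)h] × [-e, e] with e < d. The
residues at x and at the nodes add up to F(x) minus the sinc sum over |k| ≤ K
(`rectIntegral_sincKernel`). As K → ∞ the vertical edges contribute nothing; on the horizontal ones
|sin(πζ/h)| ≥ sinh(πe/h), which produces the exponential rate after e → d. The remaining integral
converges because |F(ζ)| ≤ B exp(-c |sinh Re ζ|) on the strip, with c = πμ cos d
(`MemLDE.norm_le_exp`). This rests on a sharp lower bound for |1 + exp(π sinh ζ)|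
(`le_norm_one_add_exp_pi_mul_sinh`).

Truncation: |sinc| ≤ 1 leaves the sums of |F(kh)| over k > N and k < -M. These are dominated by a
telescoping series, and M, N are chosen so that πα sinh(Mh) and πβ sinh(Nh) are at least πdn
(`MemLDE.norm_sincApprox_sub_le`). -/

namespace DESinc

/-! ### Lower bound for |1 + exp(π sinh ζ)| and decay of F on the strip. -/

open Real in
-- The right side is the tangent line of sine at s. Expanding sin(s + (r - s)) instead of using
-- concavity covers every r ≥ s, also beyond π, and the absolute value.
lemma abs_sin_le_tangent {s r : ℝ} (hs : 0 ≤ s) (hs' : s ≤ π / 2) (hr : s ≤ r) :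
    |sin r| ≤ sin s + (r - s) * cos s := by
  have h1 : sin r = sin s * cos (r - s) + cos s * sin (r - s) := by
    rw [← sin_add]; ring_nf
  have hs0 : 0 ≤ sin s := sin_nonneg_of_nonneg_of_le_pi hs (by linarith [pi_pos])
  have hc0 : 0 ≤ cos s := cos_nonneg_of_mem_Icc ⟨by linarith [pi_pos], hs'⟩
  have h2 : |sin (r - s)| ≤ r - s := by
    have := abs_sin_le_abs (x := r - s)
    rwa [abs_of_nonneg (sub_nonneg.2 hr)] at this
  calc |sin r| ≤ |sin s * cos (r - s)| + |cos s * sin (r - s)| := by rw [h1]; exact abs_add_le _ _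
    _ = sin s * |cos (r - s)| + cos s * |sin (r - s)| := by
        rw [abs_mul, abs_mul, abs_of_nonneg hs0, abs_of_nonneg hc0]
    _ ≤ sin s * 1 + cos s * (r - s) := by gcongr; exact abs_cos_le_one _
    _ = _ := by ring

open Real in
-- Combines cos s ≤ π/2 - s with Jordan's inequality sin s ≥ 2s/π.
lemma mul_cos_le_sq_sub_sq_mul_sin {s : ℝ} (hs : 0 ≤ s) (hs' : s ≤ π / 2) :
    s * cos s ≤ ((π / 2) ^ 2 - s ^ 2) * sin s := by
  have h1 : cos s ≤ π / 2 - s := by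
    rw [← sin_pi_div_two_sub]; exact sin_le (by linarith)
  have h2 := mul_le_sin hs hs'
  have hp := pi_pos
  have h3 : s ≤ (π / 2 + s) * sin s := by
    calc s = π / 2 * (2 / π * s) := by field_simp
      _ ≤ π / 2 * sin s := by gcongr
      _ ≤ _ := by nlinarith [sin_nonneg_of_nonneg_of_le_pi hs (by linarith)]
  calc s * cos s ≤ s * (π / 2 - s) := by gcongr
    _ ≤ ((π / 2 + s) * sin s) * (π / 2 - s) := mul_le_mul_of_nonneg_right h3 (by linarith)
    _ = _ := by ring

open Real in
lemma one_add_half_sq_le_cosh (z : ℝ) : 1 + z ^ 2 / 2 ≤ cosh z := by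
  have h : cosh z = 1 + 2 * sinh (z / 2) ^ 2 := by
    have h1 := cosh_two_mul (z / 2)
    have h2 := cosh_sq (z / 2)
    rw [mul_div_cancel₀ z two_ne_zero] at h1
    linarith
  have h3 : (z / 2) ^ 2 ≤ sinh (z / 2) ^ 2 := by
    rw [sq_le_sq, abs_sinh]
    exact self_le_sinh_iff.2 (abs_nonneg _)
  linarith

open Real in
-- With s = (π/2) sin y, the left side lies below the tangent line of sine at s and the right side
-- above the quadratic minorant of cosh. Both comparison terms carry the factor cosh x - 1, so the
-- claim reduces to `mul_cos_le_sq_sub_sq_mul_sin`.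
lemma abs_sin_le_cosh_mul_sin {y : ℝ} (x : ℝ) (hy : 0 ≤ y) (hy' : y ≤ π / 2) :
    |sin (π / 2 * sin y * cosh x)| ≤
      cosh (π / 2 * cos y * sinh x) * sin (π / 2 * sin y) := by
  have hp := pi_pos
  have hsy : 0 ≤ sin y := sin_nonneg_of_nonneg_of_le_pi hy (by linarith)
  have hs : 0 ≤ π / 2 * sin y := by positivity
  have hs' : π / 2 * sin y ≤ π / 2 := by nlinarith [sin_le_one y]
  have hc := one_le_cosh x
  have h1 := abs_sin_le_tangent hs hs' (le_mul_of_one_le_right hs hc)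
  have h2 := mul_cos_le_sq_sub_sq_mul_sin hs hs'
  have h3 := one_add_half_sq_le_cosh (π / 2 * cos y * sinh x)
  have h4 : 0 ≤ sin (π / 2 * sin y) := sin_nonneg_of_nonneg_of_le_pi hs (by linarith)
  have h5 : (π / 2) ^ 2 - (π / 2 * sin y) ^ 2 = (π / 2 * cos y) ^ 2 := by
    rw [mul_pow, mul_pow, cos_sq']; ring
  have h6 : sinh x ^ 2 = (cosh x - 1) * (cosh x + 1) := by rw [sinh_sq]; ring
  set s := π / 2 * sin y
  calc |sin (s * cosh x)| ≤ sin s + (s * cosh x - s) * cos s := h1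
    _ = sin s + (cosh x - 1) * (s * cos s) := by ring
    _ ≤ sin s + (cosh x - 1) * (((π / 2) ^ 2 - s ^ 2) * sin s) := by
        gcongr
    _ ≤ (1 + (π / 2 * cos y * sinh x) ^ 2 / 2) * sin s := by
        rw [h5, mul_pow _ (sinh x), h6]
        -- Since sinh² x / 2 = (cosh x - 1) + (cosh x - 1)² / 2, half of this quantity is exactly
        -- the slack.
        have : 0 ≤ (π / 2 * cos y) ^ 2 * sin s * (cosh x - 1) * (cosh x - 1) :=
          mul_nonneg (mul_nonneg (by positivity) (by linarith)) (by linarith)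
        linarith
    _ ≤ _ := by gcongr

/-- Here 1 + e^w = 2 e^(w/2) cosh(w/2), and |cosh(a + ib)|² = cosh² a - sin² b. -/
lemma normSq_one_add_exp (w : ℂ) :
    ‖1 + Complex.exp w‖ ^ 2 =
      4 * Real.exp w.re * (Real.cosh (w.re / 2) ^ 2 - Real.sin (w.im / 2) ^ 2) := by
  have h1 : Real.cos w.im = 1 - 2 * Real.sin (w.im / 2) ^ 2 := by
    have h1 := Real.cos_two_mul (w.im / 2)
    have h2 := Real.cos_sq' (w.im / 2)
    rw [mul_div_cancel₀ _ two_ne_zero] at h1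
    linarith
  have h2 : Real.exp w.re = Real.exp (w.re / 2) ^ 2 := by
    rw [← Real.exp_nat_mul]; congr 1; push_cast; ring
  have h3 : Real.exp (w.re / 2) * Real.exp (-(w.re / 2)) = 1 := by
    rw [← Real.exp_add]; simp
  have h4 := Real.sin_sq_add_cos_sq w.im
  rw [← Complex.normSq_eq_norm_sq, Complex.normSq_apply]
  simp only [Complex.add_re, Complex.add_im, Complex.one_re, Complex.one_im, Complex.exp_re,
    Complex.exp_im]
  rw [Real.cosh_eq]
  set a := Real.exp (w.re / 2)
  set b := Real.exp (-(w.re / 2))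
  rw [h2]
  have : 4 * a ^ 2 * (((a + b) / 2) ^ 2 - Real.sin (w.im / 2) ^ 2) =
      a ^ 4 + 2 * a ^ 2 * (a * b) + (a * b) ^ 2 - 4 * a ^ 2 * Real.sin (w.im / 2) ^ 2 := by ring
  rw [this, h3]
  have : Real.sin (w.im / 2) ^ 2 = (1 - Real.cos w.im) / 2 := by linarith
  rw [this]
  linear_combination a ^ 4 * h4

lemma pi_mul_sinh_re (ζ : ℂ) :
    ((Real.pi : ℂ) * Complex.sinh ζ).re = Real.pi * (Real.sinh ζ.re * Real.cos ζ.im) := by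
  have : Complex.sinh ζ = Complex.sinh (ζ.re + ζ.im * Complex.I) := by rw [Complex.re_add_im]
  rw [Complex.re_ofReal_mul, this, Complex.sinh_add, Complex.sinh_mul_I, Complex.cosh_mul_I]
  simp only [← Complex.ofReal_sinh, ← Complex.ofReal_cosh, ← Complex.ofReal_sin,
    ← Complex.ofReal_cos]
  simp [-Complex.ofReal_sinh, -Complex.ofReal_cosh, -Complex.ofReal_sin, -Complex.ofReal_cos]

lemma pi_mul_sinh_im (ζ : ℂ) :
    ((Real.pi : ℂ) * Complex.sinh ζ).im = Real.pi * (Real.cosh ζ.re * Real.sin ζ.im) := by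
  have : Complex.sinh ζ = Complex.sinh (ζ.re + ζ.im * Complex.I) := by rw [Complex.re_add_im]
  rw [Complex.im_ofReal_mul, this, Complex.sinh_add, Complex.sinh_mul_I, Complex.cosh_mul_I]
  simp only [← Complex.ofReal_sinh, ← Complex.ofReal_cosh, ← Complex.ofReal_sin,
    ← Complex.ofReal_cos]
  simp [-Complex.ofReal_sinh, -Complex.ofReal_cosh, -Complex.ofReal_sin, -Complex.ofReal_cos]

/-- A lower bound for `1 + exp (π sinh ζ)` on the strip `|Im ζ| ≤ π / 2`. -/
lemma le_norm_one_add_exp_pi_mul_sinh (ζ : ℂ) (hζ : |ζ.im| ≤ Real.pi / 2) :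
    Real.cos (Real.pi / 2 * Real.sin |ζ.im|) *
        (1 + Real.exp (Real.pi * (Real.sinh ζ.re * Real.cos ζ.im))) ≤
      ‖1 + Complex.exp (Real.pi * Complex.sinh ζ)‖ := by
  refine le_of_sq_le_sq ?_ (norm_nonneg _)
  rw [normSq_one_add_exp, pi_mul_sinh_re, pi_mul_sinh_im]
  have h1 := abs_sin_le_cosh_mul_sin ζ.re (abs_nonneg ζ.im) hζ
  rw [Real.cos_abs] at h1
  have h2 : Real.sin (Real.pi * (Real.cosh ζ.re * Real.sin ζ.im) / 2) ^ 2 =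
      Real.sin (Real.pi / 2 * Real.sin |ζ.im| * Real.cosh ζ.re) ^ 2 := by
    rcases abs_cases ζ.im with ⟨h, -⟩ | ⟨h, -⟩ <;> rw [h]
    · congr 2; ring
    · rw [Real.sin_neg, mul_neg, neg_mul, Real.sin_neg, neg_sq]; congr 2; ring
  have h3 : Real.sin (Real.pi / 2 * Real.sin |ζ.im| * Real.cosh ζ.re) ^ 2 ≤
      (Real.cosh (Real.pi / 2 * Real.cos ζ.im * Real.sinh ζ.re) *
        Real.sin (Real.pi / 2 * Real.sin |ζ.im|)) ^ 2 := by
    rw [← sq_abs (Real.sin _)]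
    gcongr
  rw [h2]
  have h4 : Real.pi / 2 * Real.cos ζ.im * Real.sinh ζ.re =
      Real.pi * (Real.sinh ζ.re * Real.cos ζ.im) / 2 := by ring
  rw [h4] at h3
  set u := Real.pi * (Real.sinh ζ.re * Real.cos ζ.im)
  -- The factor 4 e^u is now common to both sides, and what remains is `h3` together with cos² = 1 -
  -- sin².
  have h5 : (1 + Real.exp u) ^ 2 = 4 * Real.exp u * Real.cosh (u / 2) ^ 2 := by
    have h2 : Real.exp u = Real.exp (u / 2) ^ 2 := by
      rw [← Real.exp_nat_mul]; congr 1; push_cast; ring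
    have h3 : Real.exp (u / 2) * Real.exp (-(u / 2)) = 1 := by
      rw [← Real.exp_add]; simp
    rw [Real.cosh_eq, h2]
    linear_combination (-2 * Real.exp (u / 2) ^ 2 - Real.exp (u / 2) * Real.exp (-(u / 2)) - 1) * h3
  rw [mul_pow, h5, Real.cos_sq']
  have := mul_le_mul_of_nonneg_left h3 (by positivity : 0 ≤ 4 * Real.exp u)
  linarith

/-- Only the factor that grows in the direction of u is kept; the other is at least 1. The sign
change u ↦ -u swaps α and β. -/
lemma exp_mul_abs_le_mul_rpow {α β μ : ℝ} (hα : μ ≤ α) (hβ : μ ≤ β) (hμ : 0 ≤ μ) (u : ℝ) :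
    Real.exp (μ * |u|) ≤ (1 + Real.exp (-u)) ^ α * (1 + Real.exp u) ^ β := by
  have key : ∀ {a b : ℝ}, μ ≤ a → μ ≤ b → ∀ v : ℝ, 0 ≤ v →
      Real.exp (μ * v) ≤ (1 + Real.exp (-v)) ^ a * (1 + Real.exp v) ^ b := by
    intro a b ha hb v hv
    have h1 : (1 : ℝ) ≤ (1 + Real.exp (-v)) ^ a :=
      Real.one_le_rpow (by linarith [Real.exp_pos (-v)]) (by linarith)
    calc Real.exp (μ * v) ≤ Real.exp (v * b) := by
          apply Real.exp_le_exp.2; rw [mul_comm]; gcongr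
      _ = Real.exp v ^ b := Real.exp_mul v b
      _ ≤ (1 + Real.exp v) ^ b :=
        Real.rpow_le_rpow (Real.exp_pos _).le (by linarith) (by linarith)
      _ ≤ _ := le_mul_of_one_le_left (by positivity) h1
  rcases le_total 0 u with hu | hu
  · rw [abs_of_nonneg hu]; exact key hα hβ u hu
  · rw [abs_of_nonpos hu, mul_comm ((1 + Real.exp (-u)) ^ α)]
    simpa using key hβ hα (-u) (by linarith)

/-- Decay of the functions of the class on the strip. -/
lemma MemLDE.norm_le_exp {L R α β d : ℝ} {F : ℂ → ℂ} (hF : MemLDE L R α β d F) (hL : 0 < L)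
    (hα : 0 < α) (hβ : 0 < β) (hd' : d < Real.pi / 2) {ζ : ℂ} (hζ : ζ ∈ strip d) :
    ‖F ζ‖ ≤ L / Real.cos (Real.pi / 2 * Real.sin d) ^ (α + β) *
      Real.exp (-(Real.pi * min α β * Real.cos d * |Real.sinh ζ.re|)) := by
  have hp := Real.pi_pos
  have hζd : |ζ.im| < d := hζ
  have hζ0 := abs_nonneg ζ.im
  have hζ' : |ζ.im| ≤ Real.pi / 2 := by linarith
  have hsd : Real.sin d < 1 := by
    rw [← Real.sin_pi_div_two]
    exact Real.sin_lt_sin_of_lt_of_le_pi_div_two (by linarith) le_rfl hd'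
  have hsd0 : 0 ≤ Real.sin d := Real.sin_nonneg_of_nonneg_of_le_pi (by linarith) (by linarith)
  have hc : 0 < Real.cos (Real.pi / 2 * Real.sin d) :=
    Real.cos_pos_of_mem_Ioo ⟨by nlinarith, by nlinarith⟩
  have hss : Real.sin |ζ.im| ≤ Real.sin d :=
    Real.sin_le_sin_of_le_of_le_pi_div_two (by linarith) hd'.le hζd.le
  have hs0 : 0 ≤ Real.sin |ζ.im| := Real.sin_nonneg_of_nonneg_of_le_pi hζ0 (by linarith)
  have hcc : Real.cos (Real.pi / 2 * Real.sin d) ≤ Real.cos (Real.pi / 2 * Real.sin |ζ.im|) :=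
    Real.cos_le_cos_of_nonneg_of_le_pi (by positivity) (by nlinarith) (by gcongr)
  have hcos : Real.cos d ≤ Real.cos ζ.im := by
    rw [← Real.cos_abs ζ.im]
    exact Real.cos_le_cos_of_nonneg_of_le_pi hζ0 (by linarith) hζd.le
  have hcd : 0 < Real.cos d := Real.cos_pos_of_mem_Ioo ⟨by linarith, hd'⟩
  have h1 := le_norm_one_add_exp_pi_mul_sinh ζ hζ'
  have h2 := le_norm_one_add_exp_pi_mul_sinh (-ζ) (by simpa using hζ')
  simp only [Complex.neg_im, Complex.neg_re, abs_neg, Real.sinh_neg, Real.cos_neg,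
    Complex.sinh_neg, neg_mul, mul_neg] at h2
  set u := Real.pi * (Real.sinh ζ.re * Real.cos ζ.im) with hu
  set k := Real.cos (Real.pi / 2 * Real.sin d)
  have h1' : k * (1 + Real.exp u) ≤ _ := (mul_le_mul_of_nonneg_right hcc (by positivity)).trans h1
  have h2' : k * (1 + Real.exp (-u)) ≤ _ :=
    (mul_le_mul_of_nonneg_right hcc (by positivity)).trans h2
  have h3 := exp_mul_abs_le_mul_rpow (min_le_left α β) (min_le_right α β) (le_min hα.le hβ.le) u
  have h4 : k ^ (α + β) * Real.exp (Real.pi * min α β * Real.cos d * |Real.sinh ζ.re|) ≤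
      ‖1 + Complex.exp (-(Real.pi * Complex.sinh ζ))‖ ^ α *
        ‖1 + Complex.exp (Real.pi * Complex.sinh ζ)‖ ^ β := by
    calc _ ≤ k ^ (α + β) * Real.exp (min α β * |u|) := by
          refine mul_le_mul_of_nonneg_left (Real.exp_le_exp.2 ?_) (by positivity)
          rw [hu, abs_mul, abs_mul, abs_of_pos hp, abs_of_nonneg (hcd.le.trans hcos)]
          have : 0 ≤ Real.pi * min α β * |Real.sinh ζ.re| := by
            have := le_min hα.le hβ.le
            positivity
          nlinarith
      _ ≤ k ^ (α + β) * ((1 + Real.exp (-u)) ^ α * (1 + Real.exp u) ^ β) := by gcongr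
      _ = (k * (1 + Real.exp (-u))) ^ α * (k * (1 + Real.exp u)) ^ β := by
          rw [Real.mul_rpow hc.le (by positivity), Real.mul_rpow hc.le (by positivity),
            Real.rpow_add hc]
          ring
      _ ≤ _ := by gcongr
  refine (hF.bound_strip ζ hζ).trans ?_
  rw [Real.exp_neg, ← div_eq_mul_inv, div_div]
  gcongr

end DESinc

/-! ### Residue theorem on rectangles for simple poles on the real axis. -/

namespace DESinc

open Set Filter Topology

/-- The contour integral along the boundary of `[a, b] × [-e, e]`, counterclockwise. -/
noncomputable def rectIntegral (f : ℂ → ℂ) (a b e : ℝ) : ℂ :=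
  (∫ x in a..b, f (x + (-e : ℝ) * Complex.I)) - (∫ x in a..b, f (x + (e : ℝ) * Complex.I)) +
    Complex.I * (∫ y in (-e)..e, f (b + y * Complex.I)) -
    Complex.I * ∫ y in (-e)..e, f (a + y * Complex.I)

/-- The closed rectangle `[a, b] × [-e, e]`. -/
def rect (a b e : ℝ) : Set ℂ := {z | z.re ∈ Icc a b ∧ z.im ∈ Icc (-e) e}

/-- The boundary of the rectangle `[a, b] × [-e, e]`. -/
def rectFrame (a b e : ℝ) : Set ℂ :=
  {z | z ∈ rect a b e ∧ (z.re = a ∨ z.re = b ∨ z.im = -e ∨ z.im = e)}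

section

variable {a b e : ℝ} {f g : ℂ → ℂ}

lemma horizontal_mem_rectFrame (he : 0 ≤ e) {y : ℝ} (hy : y = -e ∨ y = e) {x : ℝ}
    (hx : x ∈ Icc a b) : ((x : ℂ) + (y : ℂ) * Complex.I) ∈ rectFrame a b e := by
  rcases hy with rfl | rfl <;> simp_all [rectFrame, rect]

lemma vertical_mem_rectFrame (hab : a ≤ b) {x : ℝ} (hx : x = a ∨ x = b) {y : ℝ}
    (hy : y ∈ Icc (-e) e) : ((x : ℂ) + (y : ℂ) * Complex.I) ∈ rectFrame a b e := by
  rcases hx with rfl | rfl <;> simp_all [rectFrame, rect]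

lemma intervalIntegrable_horizontal (hab : a ≤ b) (he : 0 ≤ e)
    (hf : ContinuousOn f (rectFrame a b e)) {y : ℝ} (hy : y = -e ∨ y = e) :
    IntervalIntegrable (fun x : ℝ => f (x + (y : ℂ) * Complex.I)) MeasureTheory.volume a b := by
  apply ContinuousOn.intervalIntegrable
  rw [uIcc_of_le hab]
  exact hf.comp (by fun_prop) fun x hx => horizontal_mem_rectFrame he hy hx

lemma intervalIntegrable_vertical (hab : a ≤ b) (he : 0 ≤ e)
    (hf : ContinuousOn f (rectFrame a b e)) {x : ℝ} (hx : x = a ∨ x = b) :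
    IntervalIntegrable (fun y : ℝ => f (x + (y : ℂ) * Complex.I)) MeasureTheory.volume (-e) e := by
  apply ContinuousOn.intervalIntegrable
  rw [uIcc_of_le (by linarith)]
  exact hf.comp (by fun_prop) fun y hy => vertical_mem_rectFrame hab hx hy

lemma rectIntegral_congr (hab : a ≤ b) (he : 0 ≤ e) (h : EqOn f g (rectFrame a b e)) :
    rectIntegral f a b e = rectIntegral g a b e := by
  have hh : ∀ y : ℝ, (y = -e ∨ y = e) → (∫ x in a..b, f (x + (y : ℂ) * Complex.I)) =
      ∫ x in a..b, g (x + (y : ℂ) * Complex.I) := fun y hy =>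
    intervalIntegral.integral_congr fun x hx => by
      rw [uIcc_of_le hab] at hx
      exact h (horizontal_mem_rectFrame he hy hx)
  have hv : ∀ x : ℝ, (x = a ∨ x = b) → (∫ y in (-e)..e, f (x + (y : ℂ) * Complex.I)) =
      ∫ y in (-e)..e, g (x + (y : ℂ) * Complex.I) := fun x hx =>
    intervalIntegral.integral_congr fun y hy => by
      rw [uIcc_of_le (by linarith)] at hy
      exact h (vertical_mem_rectFrame hab hx hy)
  simp only [rectIntegral, hh (-e) (.inl rfl), hh e (.inr rfl), hv a (.inl rfl), hv b (.inr rfl)]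

lemma rectIntegral_add (hab : a ≤ b) (he : 0 ≤ e) (hf : ContinuousOn f (rectFrame a b e))
    (hg : ContinuousOn g (rectFrame a b e)) :
    rectIntegral (fun z => f z + g z) a b e = rectIntegral f a b e + rectIntegral g a b e := by
  have hh : ∀ y : ℝ, (y = -e ∨ y = e) →
      (∫ x in a..b, (f (x + (y : ℂ) * Complex.I) + g (x + (y : ℂ) * Complex.I))) =
      (∫ x in a..b, f (x + (y : ℂ) * Complex.I)) + ∫ x in a..b, g (x + (y : ℂ) * Complex.I) :=
    fun y hy => intervalIntegral.integral_add (intervalIntegrable_horizontal hab he hf hy)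
      (intervalIntegrable_horizontal hab he hg hy)
  have hv : ∀ x : ℝ, (x = a ∨ x = b) →
      (∫ y in (-e)..e, (f (x + (y : ℂ) * Complex.I) + g (x + (y : ℂ) * Complex.I))) =
      (∫ y in (-e)..e, f (x + (y : ℂ) * Complex.I)) +
        ∫ y in (-e)..e, g (x + (y : ℂ) * Complex.I) :=
    fun x hx => intervalIntegral.integral_add (intervalIntegrable_vertical hab he hf hx)
      (intervalIntegrable_vertical hab he hg hx)
  simp only [rectIntegral, hh (-e) (.inl rfl), hh e (.inr rfl), hv a (.inl rfl), hv b (.inr rfl)]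
  ring

lemma rectIntegral_const_mul (r : ℂ) :
    rectIntegral (fun z => r * f z) a b e = r * rectIntegral f a b e := by
  simp only [rectIntegral, intervalIntegral.integral_const_mul]
  ring

lemma rectIntegral_eq_zero (hab : a ≤ b) (he : 0 ≤ e) (hf : DifferentiableOn ℂ f (rect a b e)) :
    rectIntegral f a b e = 0 := by
  have := Complex.integral_boundary_rect_eq_zero_of_differentiableOn f
    ((a : ℂ) + (-e : ℝ) * Complex.I) ((b : ℂ) + (e : ℝ) * Complex.I) (hf.mono ?_)
  · simpa [rectIntegral] using this
  · intro z hz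
    rw [Complex.mem_reProdIm] at hz
    simpa [rect, uIcc_of_le hab, uIcc_of_le (show -e ≤ e by linarith)] using hz

lemma ofReal_notMem_rectFrame (he : 0 < e) {c : ℝ} (hc : c ∈ Ioo a b) :
    (c : ℂ) ∉ rectFrame a b e := by
  rintro ⟨-, h | h | h | h⟩
  · exact hc.1.ne' (by simpa using h)
  · exact hc.2.ne (by simpa using h)
  · simp at h; exact he.ne' h
  · simp at h; exact he.ne h

lemma log_neg_of_im_pos {z : ℂ} (hz : 0 < z.im) :
    Complex.log (-z) = Complex.log z - Real.pi * Complex.I := by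
  rw [Complex.log, Complex.log, norm_neg, Complex.arg_neg_eq_arg_sub_pi_of_im_pos hz]
  push_cast; ring

/-- The principal logarithm is a primitive on three edges. The left edge crosses its cut, so log(-(z
- c)) is used there; the two branches differ by πi at each left corner, in directions that add up to
2πi. -/
lemma rectIntegral_inv_sub (he : 0 < e) {c : ℝ} (hc : c ∈ Ioo a b) :
    rectIntegral (fun z => (z - c)⁻¹) a b e = 2 * Real.pi * Complex.I := by
  have hab : a < b := hc.1.trans hc.2
  have hcont : ContinuousOn (fun z : ℂ => (z - c)⁻¹) (rectFrame a b e) :=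
    ContinuousOn.inv₀ (by fun_prop) fun z hz h => ofReal_notMem_rectFrame he hc (by
      rwa [sub_eq_zero.1 h] at hz)
  have hh : ∀ y : ℝ, (y = -e ∨ y = e) → (∫ x in a..b, ((x : ℂ) + (y : ℂ) * Complex.I - c)⁻¹) =
      Complex.log (b + (y : ℂ) * Complex.I - c) - Complex.log (a + (y : ℂ) * Complex.I - c) := by
    intro y hy
    have hy0 : y ≠ 0 := by rcases hy with rfl | rfl <;> simp [he.ne']
    refine intervalIntegral.integral_eq_sub_of_hasDerivAt
      (f := fun x : ℝ => Complex.log (x + (y : ℂ) * Complex.I - c)) (fun x _ => ?_)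
      (intervalIntegrable_horizontal hab.le he.le hcont hy)
    have h1 : HasDerivAt (fun z : ℂ => z + (y : ℂ) * Complex.I - c) 1 (x : ℂ) :=
      ((hasDerivAt_id _).add_const _).sub_const _
    have h2 := (h1.clog (Or.inr (by simpa using hy0))).comp_ofReal
    simpa using h2
  have hr : (∫ y in (-e)..e, ((b : ℂ) + (y : ℂ) * Complex.I - c)⁻¹) =
      -Complex.I * Complex.log (b + (e : ℝ) * Complex.I - c) -
        -Complex.I * Complex.log (b + (-e : ℝ) * Complex.I - c) := by
    refine intervalIntegral.integral_eq_sub_of_hasDerivAt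
      (f := fun y : ℝ => -Complex.I * Complex.log (b + (y : ℂ) * Complex.I - c)) (fun y _ => ?_)
      (intervalIntegrable_vertical hab.le he.le hcont (.inr rfl))
    have h1 : HasDerivAt (fun z : ℂ => b + z * Complex.I - c) Complex.I (y : ℂ) := by
      simpa using (((hasDerivAt_id (y : ℂ)).mul_const Complex.I).const_add (b : ℂ)).sub_const (c : ℂ)
    have h2 := ((h1.clog (Or.inl (by simpa using hc.2))).const_mul (-Complex.I)).comp_ofReal
    refine h2.congr_deriv ?_
    rw [← mul_div_assoc]; simp
  have hl : (∫ y in (-e)..e, ((a : ℂ) + (y : ℂ) * Complex.I - c)⁻¹) =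
      -Complex.I * Complex.log (-(a + (e : ℝ) * Complex.I - c)) -
        -Complex.I * Complex.log (-(a + (-e : ℝ) * Complex.I - c)) := by
    refine intervalIntegral.integral_eq_sub_of_hasDerivAt
      (f := fun y : ℝ => -Complex.I * Complex.log (-(a + (y : ℂ) * Complex.I - c))) (fun y _ => ?_)
      (intervalIntegrable_vertical hab.le he.le hcont (.inl rfl))
    have h1 : HasDerivAt (fun z : ℂ => -(a + z * Complex.I - c)) (-Complex.I) (y : ℂ) := by
      simpa only [one_mul, id] using
        ((((hasDerivAt_id (y : ℂ)).mul_const Complex.I).const_add (a : ℂ)).sub_const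
          (c : ℂ)).fun_neg
    have h2 := ((h1.clog (Or.inl (by simpa using hc.1))).const_mul (-Complex.I)).comp_ofReal
    refine h2.congr_deriv ?_
    rw [neg_div_neg_eq, ← mul_div_assoc]; simp
  have h1 := log_neg_of_im_pos (z := (a : ℂ) + (e : ℝ) * Complex.I - c) (by simpa using he)
  have h2 := log_neg_of_im_pos (z := -((a : ℂ) + (-e : ℝ) * Complex.I - c)) (by simpa using he)
  rw [neg_neg] at h2
  rw [rectIntegral, hh _ (.inl rfl), hh _ (.inr rfl), hr, hl, h1, h2]
  ring_nf
  simp only [Complex.I_sq, Complex.I_pow_three]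
  ring

/-- **Residue theorem** on a rectangle for finitely many simple poles on the real axis. -/
theorem rectIntegral_eq_sum_residues (hab : a < b) (he : 0 < e) {U : Set ℂ} (hU : IsOpen U)
    (hUr : rect a b e ⊆ U) (r : ℝ → ℂ) (S : Finset ℝ) (hS : ∀ c ∈ S, c ∈ Ioo a b) (f : ℂ → ℂ)
    (hf : ∀ z ∈ U, (∀ c ∈ S, z ≠ (c : ℂ)) → DifferentiableAt ℂ f z)
    (hr : ∀ c ∈ S, Tendsto (fun z : ℂ => (z - c) * f z) (𝓝[≠] (c : ℂ)) (𝓝 (r c))) :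
    rectIntegral f a b e = 2 * Real.pi * Complex.I * ∑ c ∈ S, r c := by
  induction S using Finset.induction_on generalizing f with
  | empty =>
    rw [Finset.sum_empty, mul_zero]
    exact rectIntegral_eq_zero hab.le he.le fun z hz =>
      (hf z (hUr hz) (by simp)).differentiableWithinAt
  | insert c S hcS ih =>
    -- Subtracting the principal part at c makes the singularity removable, and `g'` fills it in,
    -- leaving a function with poles only in S.
    set g : ℂ → ℂ := fun z => f z - r c * (z - c)⁻¹ with hg
    set g' : ℂ → ℂ := Function.update g c (limUnder (𝓝[≠] (c : ℂ)) g) with hg'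
    have hcI := hS c (Finset.mem_insert_self _ _)
    have hcU : (c : ℂ) ∈ U := hUr ⟨by simpa using ⟨hcI.1.le, hcI.2.le⟩, by simpa using he.le⟩
    have hgd : ∀ z ∈ U, (∀ s ∈ insert c S, z ≠ (s : ℂ)) → DifferentiableAt ℂ g z := by
      intro z hz hzs
      refine (hf z hz hzs).sub ((DifferentiableAt.inv (by fun_prop) ?_).const_mul _)
      exact sub_ne_zero.2 (hzs c (Finset.mem_insert_self _ _))
    have hV : ∀ z ∈ U, (∀ s ∈ S, z ≠ (s : ℂ)) →
        U ∩ ((S.image (fun s : ℝ => (s : ℂ)) : Finset ℂ) : Set ℂ)ᶜ ∈ 𝓝 z := by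
      intro z hz hzs
      refine (hU.inter (Finset.finite_toSet _).isClosed.isOpen_compl).mem_nhds ⟨hz, ?_⟩
      simpa using fun s hs h => hzs s hs h.symm
    have hcs : ∀ s ∈ S, (c : ℂ) ≠ (s : ℂ) := fun s hs h =>
      hcS (by rw [Complex.ofReal_inj.1 h]; exact hs)
    have hlim : Tendsto (fun z : ℂ => (z - c) * g z) (𝓝[≠] (c : ℂ)) (𝓝 0) := by
      have h1 := (hr c (Finset.mem_insert_self _ _)).sub_const (r c)
      rw [sub_self] at h1
      refine h1.congr' ?_
      filter_upwards [self_mem_nhdsWithin] with z hz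
      have : z - c ≠ 0 := sub_ne_zero.2 hz
      rw [hg]; field_simp
    -- The growth hypothesis of the removable singularity theorem, which follows from (z - c) g(z) →
    -- 0.
    have hlittle : (fun z => g z - g c) =o[𝓝[≠] (c : ℂ)] fun z => (z - c)⁻¹ := by
      rw [Asymptotics.isLittleO_iff_tendsto']
      · have h2 : Tendsto (fun z : ℂ => (z - c) * g c) (𝓝[≠] (c : ℂ)) (𝓝 0) := by
          have : Tendsto (fun z : ℂ => (z - c) * g c) (𝓝 (c : ℂ)) (𝓝 (((c : ℂ) - c) * g c)) :=
            Continuous.tendsto (by fun_prop) _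
          rw [sub_self, zero_mul] at this
          exact this.mono_left nhdsWithin_le_nhds
        have h3 := hlim.sub h2
        rw [sub_self] at h3
        refine h3.congr fun z => ?_
        rw [div_inv_eq_mul]; ring
      · filter_upwards [self_mem_nhdsWithin] with z hz h0
        exact absurd (inv_eq_zero.1 h0) (sub_ne_zero.2 hz)
    have hd' := Complex.differentiableOn_update_limUnder_of_isLittleO (hV c hcU hcs)
      (f := g) (fun z hz => (hgd z hz.1.1 (by
        have := hz.1.2
        have h2 : z ≠ c := hz.2
        simp only [Finset.mem_insert, forall_eq_or_imp]
        refine ⟨h2, fun s hs h => this (by simpa using ⟨s, hs, h.symm⟩)⟩)).differentiableWithinAt)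
      hlittle
    have hg'd : ∀ z ∈ U, (∀ s ∈ S, z ≠ (s : ℂ)) → DifferentiableAt ℂ g' z := by
      intro z hz hzs
      exact hd'.differentiableAt (hV z hz hzs)
    have heq : ∀ z, z ≠ (c : ℂ) → g' z = g z := fun z hz => Function.update_of_ne hz _ _
    have hr' : ∀ s ∈ S, Tendsto (fun z : ℂ => (z - s) * g' z) (𝓝[≠] (s : ℂ)) (𝓝 (r s)) := by
      intro s hs
      have hne : (s : ℂ) ≠ c := (hcs s hs).symm
      have h1 := hr s (Finset.mem_insert_of_mem hs)
      have h2 : Tendsto (fun z : ℂ => (z - s) * (r c * (z - c)⁻¹)) (𝓝[≠] (s : ℂ)) (𝓝 0) := by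
        have : ContinuousAt (fun z : ℂ => (z - s) * (r c * (z - c)⁻¹)) (s : ℂ) := by
          refine ContinuousAt.mul (by fun_prop) (continuousAt_const.mul (ContinuousAt.inv₀
            (by fun_prop) (sub_ne_zero.2 hne)))
        have h3 := this.tendsto
        rw [sub_self, zero_mul] at h3
        exact h3.mono_left nhdsWithin_le_nhds
      have h3 := h1.sub h2
      rw [sub_zero] at h3
      refine h3.congr' ?_
      filter_upwards [nhdsWithin_le_nhds (isOpen_ne.mem_nhds hne)] with z hz
      rw [heq z hz, hg]; ring
    have hint := ih (fun s hs => hS s (Finset.mem_insert_of_mem hs)) g' hg'd hr'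
    have hframe : ∀ z ∈ rectFrame a b e, z ≠ (c : ℂ) := fun z hz h =>
      ofReal_notMem_rectFrame he hcI (h ▸ hz)
    have hframe' : ∀ z ∈ rectFrame a b e, ∀ s ∈ S, z ≠ (s : ℂ) := fun z hz s hs h =>
      ofReal_notMem_rectFrame he (hS s (Finset.mem_insert_of_mem hs)) (h ▸ hz)
    have hfg : rectIntegral f a b e =
        rectIntegral (fun z => g' z + r c * (z - c)⁻¹) a b e :=
      rectIntegral_congr hab.le he.le fun z hz => by
        simp only [heq z (hframe z hz), hg]; ring
    rw [hfg, rectIntegral_add hab.le he.le, hint, rectIntegral_const_mul,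
      rectIntegral_inv_sub he hcI, Finset.sum_insert hcS]
    · ring
    · exact fun z hz => (hg'd z (hUr hz.1) (hframe' z hz)).continuousAt.continuousWithinAt
    · exact continuousOn_const.mul (ContinuousOn.inv₀ (by fun_prop)
        fun z hz => sub_ne_zero.2 (hframe z hz))

end

end DESinc

/-! ### Truncation error. -/

namespace DESinc

lemma abs_nsinc_le_one (x : ℝ) : |nsinc x| ≤ 1 := Real.abs_sinc_le_one _

lemma MemLDE.norm_le_exp_neg {L R α β d : ℝ} {F : ℂ → ℂ} (hF : MemLDE L R α β d F)
    (hR : 0 ≤ R) (hα : 0 ≤ α) (hβ : 0 ≤ β) (x : ℝ) :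
    ‖F x‖ ≤ R * Real.exp (-(Real.pi * β * Real.sinh x)) := by
  refine (hF.bound_real x).trans ?_
  rw [Real.exp_neg (Real.pi * β * Real.sinh x), ← div_eq_mul_inv]
  have h1 : 1 ≤ (1 + Real.exp (-(Real.pi * Real.sinh x))) ^ α :=
    Real.one_le_rpow (by linarith [Real.exp_pos (-(Real.pi * Real.sinh x))]) hα
  have h2 : Real.exp (Real.pi * β * Real.sinh x) ≤
      (1 + Real.exp (Real.pi * Real.sinh x)) ^ β := by
    calc _ = Real.exp (Real.pi * Real.sinh x) ^ β := by rw [← Real.exp_mul]; ring_nf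
      _ ≤ _ := Real.rpow_le_rpow (Real.exp_pos _).le (by linarith) hβ
  gcongr
  exact h2.trans (le_mul_of_one_le_left (by positivity) h1)

lemma MemLDE.norm_le_exp_pos {L R α β d : ℝ} {F : ℂ → ℂ} (hF : MemLDE L R α β d F)
    (hR : 0 ≤ R) (hα : 0 ≤ α) (hβ : 0 ≤ β) (x : ℝ) :
    ‖F x‖ ≤ R * Real.exp (Real.pi * α * Real.sinh x) := by
  refine (hF.bound_real x).trans ?_
  rw [← neg_neg (Real.pi * α * Real.sinh x), Real.exp_neg (-(Real.pi * α * Real.sinh x)),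
    ← div_eq_mul_inv]
  have h1 : 1 ≤ (1 + Real.exp (Real.pi * Real.sinh x)) ^ β :=
    Real.one_le_rpow (by linarith [Real.exp_pos (Real.pi * Real.sinh x)]) hβ
  have h2 : Real.exp (-(Real.pi * α * Real.sinh x)) ≤
      (1 + Real.exp (-(Real.pi * Real.sinh x))) ^ α := by
    calc _ = Real.exp (-(Real.pi * Real.sinh x)) ^ α := by rw [← Real.exp_mul]; ring_nf
      _ ≤ _ := Real.rpow_le_rpow (Real.exp_pos _).le (by linarith) hα
  gcongr
  exact h2.trans (le_mul_of_one_le_right (by positivity) h1)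

/-- Beyond N the exponents b sinh(kh) grow by at least κ per step. Since e^t - 1 ≥ t, κ times each
term is at most the drop of the exponential over that step, and the sum telescopes. -/
lemma mul_sum_exp_neg_sinh_le {b h κ : ℝ} (hb : 0 ≤ b) (hh : 0 ≤ h) {N K : ℤ} (hN : 0 ≤ N)
    (hκ : κ ≤ b * h * Real.sinh (N * h)) (hNK : N ≤ K) :
    κ * ∑ k ∈ Finset.Ioc N K, Real.exp (-(b * Real.sinh (k * h))) ≤
      Real.exp (-(b * Real.sinh (N * h))) := by
  suffices H : κ * ∑ k ∈ Finset.Ioc N K, Real.exp (-(b * Real.sinh (k * h))) ≤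
      Real.exp (-(b * Real.sinh (N * h))) - Real.exp (-(b * Real.sinh (K * h))) by
    linarith [Real.exp_pos (-(b * Real.sinh (K * h)))]
  induction K, hNK using Int.leInduction with
  | base => simp
  | succ K hK ih =>
    have hins : Finset.Ioc N (K + 1) = insert (K + 1) (Finset.Ioc N K) := by
      ext k; simp only [Finset.mem_Ioc, Finset.mem_insert]; omega
    rw [hins, Finset.sum_insert (by simp), mul_add]
    have hKR : (N : ℝ) ≤ K := by exact_mod_cast hK
    have hNR : (0 : ℝ) ≤ N := by exact_mod_cast hN
    -- By the addition formula, using cosh h ≥ 1, sinh h ≥ h and cosh(Kh) ≥ sinh(Nh).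
    have hstep : Real.sinh (K * h) + h * Real.sinh (N * h) ≤ Real.sinh ((K + 1 : ℤ) * h) := by
      have h1 : ((K + 1 : ℤ) : ℝ) * h = K * h + h := by push_cast; ring
      rw [h1, Real.sinh_add]
      have h2 : Real.sinh (N * h) ≤ Real.sinh (K * h) := Real.sinh_le_sinh.2 (by gcongr)
      have h3 : Real.sinh (K * h) ≤ Real.cosh (K * h) := (Real.sinh_lt_cosh _).le
      have h4 := Real.self_le_sinh_iff.2 hh
      have h5 : 0 ≤ Real.sinh (K * h) := Real.sinh_nonneg_iff.2 (by nlinarith)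
      have h6 := Real.one_le_cosh h
      have h7 : h * Real.sinh (N * h) ≤ Real.cosh (K * h) * Real.sinh h := by
        rw [mul_comm]
        exact mul_le_mul (h2.trans h3) h4 hh (h5.trans h3)
      nlinarith
    have hκ' : κ ≤ b * Real.sinh ((K + 1 : ℤ) * h) - b * Real.sinh (K * h) := by
      nlinarith [mul_le_mul_of_nonneg_left hstep hb]
    have hexp : κ * Real.exp (-(b * Real.sinh ((K + 1 : ℤ) * h))) ≤
        Real.exp (-(b * Real.sinh (K * h))) - Real.exp (-(b * Real.sinh ((K + 1 : ℤ) * h))) := by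
      set q := b * Real.sinh ((K + 1 : ℤ) * h)
      set p := b * Real.sinh (K * h)
      have h1 : Real.exp (-p) = Real.exp (-q) * Real.exp (q - p) := by
        rw [← Real.exp_add]; ring_nf
      have h2 := Real.add_one_le_exp (q - p)
      rw [h1]
      nlinarith [Real.exp_pos (-q)]
    linarith

lemma le_sinh_ceil_arsinh_mul {h t : ℝ} (hh : 0 < h) :
    t ≤ Real.sinh (⌈1 / h * Real.arsinh t⌉ * h) := by
  rw [← Real.arsinh_le_arsinh, Real.arsinh_sinh]
  calc Real.arsinh t = 1 / h * Real.arsinh t * h := by field_simp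
    _ ≤ _ := by gcongr; exact Int.le_ceil _

lemma ceil_arsinh_nonneg {h t : ℝ} (hh : 0 < h) (ht : 0 ≤ t) :
    0 ≤ ⌈1 / h * Real.arsinh t⌉ :=
  Int.ceil_nonneg (mul_nonneg (by positivity) (Real.arsinh_nonneg_iff.2 ht))

/-- The tail of the series of node values in the double exponential setting. -/
lemma sum_exp_neg_sinh_ceil_le {β d h : ℝ} (hβ : 0 < β) (hd : 0 < d) (hh : 0 < h) {K : ℤ}
    (hK : ⌈1 / h * Real.arsinh (d * (1 / h) / β)⌉ ≤ K) :
    ∑ k ∈ Finset.Ioc ⌈1 / h * Real.arsinh (d * (1 / h) / β)⌉ K,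
        Real.exp (-(Real.pi * β * Real.sinh (k * h))) ≤
      Real.exp (-(Real.pi * d * (1 / h))) / (Real.pi * d) := by
  have hp := Real.pi_pos
  have h1 := le_sinh_ceil_arsinh_mul (t := d * (1 / h) / β) hh
  -- The ceiling gives sinh(Nh) ≥ d/(hβ). This one inequality yields both κ = πd and the exponent
  -- πd/h.
  have h2 := mul_sum_exp_neg_sinh_le (b := Real.pi * β) (κ := Real.pi * d) (by positivity) hh.le
    (ceil_arsinh_nonneg (t := d * (1 / h) / β) hh (by positivity)) ?_ hK
  · rw [le_div_iff₀' (by positivity)]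
    refine h2.trans (Real.exp_le_exp.2 (neg_le_neg ?_))
    calc Real.pi * d * (1 / h) = Real.pi * β * (d * (1 / h) / β) := by field_simp
      _ ≤ _ := by gcongr
  · calc Real.pi * d = Real.pi * β * h * (d * (1 / h) / β) := by field_simp
      _ ≤ _ := by gcongr

/-- The truncation error of the Sinc approximation. -/
lemma MemLDE.norm_sincApprox_sub_le {L R α β d h : ℝ} {F : ℂ → ℂ} (hF : MemLDE L R α β d F)
    (hR : 0 < R) (hα : 0 < α) (hβ : 0 < β) (hd : 0 < d) (hh : 0 < h) {M N K : ℤ}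
    (hM : M = ⌈1 / h * Real.arsinh (d * (1 / h) / α)⌉)
    (hN : N = ⌈1 / h * Real.arsinh (d * (1 / h) / β)⌉) (hMK : M ≤ K) (hNK : N ≤ K) (x : ℝ) :
    ‖sincApprox F h K K x - sincApprox F h M N x‖ ≤
      2 * R * Real.exp (-(Real.pi * d * (1 / h))) / (Real.pi * d) := by
  have hp := Real.pi_pos
  have hM0 : 0 ≤ M := by rw [hM]; exact ceil_arsinh_nonneg hh (by positivity)
  have hN0 : 0 ≤ N := by rw [hN]; exact ceil_arsinh_nonneg hh (by positivity)
  set T : ℤ → ℂ := fun k =>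
    F (((k : ℝ) * h : ℝ) : ℂ) * ((nsinc ((x - (k : ℝ) * h) / h) : ℝ) : ℂ) with hT
  have hTF : ∀ k, ‖T k‖ ≤ ‖F (((k : ℝ) * h : ℝ) : ℂ)‖ := fun k => by
    rw [hT, norm_mul, Complex.norm_real, Real.norm_eq_abs]
    exact mul_le_of_le_one_right (norm_nonneg _) (abs_nsinc_le_one _)
  -- Reflecting the left tail k ↦ -k turns it into a right tail with α in place of β.
  have hsplit : sincApprox F h K K x = sincApprox F h M N x + ∑ k ∈ Finset.Ioc N K, T k +
      ∑ k ∈ Finset.Ioc M K, T (-k) := by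
    have h1 : ∑ k ∈ Finset.Ioc M K, T (-k) = ∑ k ∈ Finset.Ico (-K) (-M), T k :=
      Finset.sum_nbij' (fun k => -k) (fun k => -k)
        (fun k hk => by simp only [Finset.mem_Ioc, Finset.mem_Ico] at hk ⊢; omega)
        (fun k hk => by simp only [Finset.mem_Ioc, Finset.mem_Ico] at hk ⊢; omega)
        (by simp) (by simp) (by simp)
    have h2 : Finset.Icc (-K) K =
        (Finset.Icc (-M) N ∪ Finset.Ioc N K) ∪ Finset.Ico (-K) (-M) := by
      ext k; simp only [Finset.mem_union, Finset.mem_Icc, Finset.mem_Ioc, Finset.mem_Ico]; omega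
    rw [h1, sincApprox, sincApprox, h2, Finset.sum_union, Finset.sum_union]
    · rw [Finset.disjoint_left]
      intro k hk; simp only [Finset.mem_Icc, Finset.mem_Ioc] at hk ⊢; omega
    · rw [Finset.disjoint_left]
      intro k hk
      simp only [Finset.mem_union, Finset.mem_Icc, Finset.mem_Ioc, Finset.mem_Ico] at hk ⊢; omega
  have hNb : ‖∑ k ∈ Finset.Ioc N K, T k‖ ≤
      R * (Real.exp (-(Real.pi * d * (1 / h))) / (Real.pi * d)) := by
    subst hN
    calc _ ≤ ∑ k ∈ Finset.Ioc _ K, R * Real.exp (-(Real.pi * β * Real.sinh (k * h))) :=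
          norm_sum_le_of_le _ fun k _ => (hTF k).trans
            (hF.norm_le_exp_neg hR.le hα.le hβ.le _)
      _ ≤ _ := by
          rw [← Finset.mul_sum]
          exact mul_le_mul_of_nonneg_left (sum_exp_neg_sinh_ceil_le hβ hd hh hNK) hR.le
  have hMb : ‖∑ k ∈ Finset.Ioc M K, T (-k)‖ ≤
      R * (Real.exp (-(Real.pi * d * (1 / h))) / (Real.pi * d)) := by
    subst hM
    calc _ ≤ ∑ k ∈ Finset.Ioc _ K, R * Real.exp (-(Real.pi * α * Real.sinh (k * h))) :=
          norm_sum_le_of_le _ fun k _ => (hTF (-k)).trans <| by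
            have := hF.norm_le_exp_pos hR.le hα.le hβ.le (((-k : ℤ) : ℝ) * h)
            simpa [Real.sinh_neg] using this
      _ ≤ _ := by
          rw [← Finset.mul_sum]
          exact mul_le_mul_of_nonneg_left (sum_exp_neg_sinh_ceil_le hα hd hh hMK) hR.le
  have : sincApprox F h K K x - sincApprox F h M N x =
      ∑ k ∈ Finset.Ioc N K, T k + ∑ k ∈ Finset.Ioc M K, T (-k) := by rw [hsplit]; ring
  rw [this]
  refine (norm_add_le_of_le hNb hMb).trans (le_of_eq (by ring))

end DESinc

/-! ### The interpolation error as a contour integral. -/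

namespace DESinc

open Set Filter Topology

section

open MeasureTheory

/-- The weight cosh t ≥ 1 is inserted because it is the derivative of sinh t, which gives an
explicit primitive on each half-line. -/
lemma integral_cosh_mul_exp_neg_abs_sinh_le {c A : ℝ} (hc : 0 < c) (hA : 0 ≤ A) :
    ∫ t in (-A)..A, Real.cosh t * Real.exp (-(c * |Real.sinh t|)) ≤ 2 / c := by
  have hcont : Continuous fun t => Real.cosh t * Real.exp (-(c * |Real.sinh t|)) := by
    have := Real.continuous_cosh; have := Real.continuous_sinh; fun_prop
  have hcs := Real.continuous_cosh
  have hsn := Real.continuous_sinh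
  have h1 : ∫ t in (0 : ℝ)..A, Real.cosh t * Real.exp (-(c * |Real.sinh t|)) ≤ 1 / c := by
    have : ∫ t in (0 : ℝ)..A, Real.cosh t * Real.exp (-(c * |Real.sinh t|)) =
        -(Real.exp (-(c * Real.sinh A)) / c) - -(Real.exp (-(c * Real.sinh 0)) / c) := by
      rw [← intervalIntegral.integral_eq_sub_of_hasDerivAt
        (f := fun t => -(Real.exp (-(c * Real.sinh t)) / c))
        (f' := fun t => Real.cosh t * Real.exp (-(c * Real.sinh t)))]
      · refine intervalIntegral.integral_congr fun t ht => ?_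
        rw [uIcc_of_le hA] at ht
        simp only [abs_of_nonneg (Real.sinh_nonneg_iff.2 ht.1)]
      · intro t _
        refine ((((Real.hasDerivAt_sinh t).const_mul c).fun_neg.exp).div_const c).fun_neg.congr_deriv
          ?_
        field_simp
      · exact Continuous.intervalIntegrable (by fun_prop) _ _
    rw [this]
    simp
    positivity
  have h2 : ∫ t in (-A)..0, Real.cosh t * Real.exp (-(c * |Real.sinh t|)) ≤ 1 / c := by
    rw [← neg_zero, ← intervalIntegral.integral_comp_neg]
    simpa [Real.sinh_neg] using h1
  rw [← intervalIntegral.integral_add_adjacent_intervals (hcont.intervalIntegrable _ 0)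
    (hcont.intervalIntegrable _ _)]
  calc _ ≤ 1 / c + 1 / c := add_le_add h2 h1
    _ = _ := by ring

lemma norm_rectIntegral_le {f : ℂ → ℂ} {A e B c V : ℝ} (hA : 0 ≤ A) (he : 0 ≤ e) (hB : 0 ≤ B)
    (hc : 0 < c)
    (hh : ∀ t ∈ Icc (-A) A, ∀ y : ℝ, (y = -e ∨ y = e) →
      ‖f (t + (y : ℂ) * Complex.I)‖ ≤ B * (Real.cosh t * Real.exp (-(c * |Real.sinh t|))))
    (hv : ∀ y ∈ Icc (-e) e, ∀ t : ℝ, (t = -A ∨ t = A) → ‖f (t + (y : ℂ) * Complex.I)‖ ≤ V) :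
    ‖rectIntegral f (-A) A e‖ ≤ 4 * B / c + 4 * e * V := by
  have hcont : Continuous fun t => B * (Real.cosh t * Real.exp (-(c * |Real.sinh t|))) := by
    have := Real.continuous_cosh; have := Real.continuous_sinh; fun_prop
  have h1 : ∀ y : ℝ, (y = -e ∨ y = e) →
      ‖∫ t in (-A)..A, f (t + (y : ℂ) * Complex.I)‖ ≤ B * (2 / c) := by
    intro y hy
    calc _ ≤ ∫ t in (-A)..A, B * (Real.cosh t * Real.exp (-(c * |Real.sinh t|))) :=
          intervalIntegral.norm_integral_le_of_norm_le (by linarith)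
            (Eventually.of_forall fun t ht => hh t (Ioc_subset_Icc_self ht) y hy)
            (hcont.intervalIntegrable _ _)
      _ ≤ _ := by
          rw [intervalIntegral.integral_const_mul]
          exact mul_le_mul_of_nonneg_left (integral_cosh_mul_exp_neg_abs_sinh_le hc hA) hB
  have h2 : ∀ t : ℝ, (t = -A ∨ t = A) →
      ‖Complex.I * ∫ y in (-e)..e, f (t + (y : ℂ) * Complex.I)‖ ≤ V * (2 * e) := by
    intro t ht
    rw [norm_mul, Complex.norm_I, one_mul]
    have := intervalIntegral.norm_integral_le_of_norm_le_const (a := -e) (b := e) (C := V)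
      (f := fun y : ℝ => f (t + (y : ℂ) * Complex.I)) (fun y hy => by
        rw [uIoc_of_le (by linarith)] at hy
        exact hv y (Ioc_subset_Icc_self hy) t ht)
    rwa [show |e - -e| = 2 * e by rw [abs_of_nonneg (by linarith)]; ring] at this
  rw [rectIntegral]
  refine (norm_sub_le_of_le (norm_add_le_of_le (norm_sub_le_of_le (h1 _ (.inl rfl))
    (h1 _ (.inr rfl))) (h2 _ (.inr rfl))) (h2 _ (.inl rfl))).trans (le_of_eq (by ring))

end

lemma norm_sin_sq (a b : ℝ) :
    ‖Complex.sin (a + b * Complex.I)‖ ^ 2 = Real.sin a ^ 2 + Real.sinh b ^ 2 := by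
  rw [Complex.sin_add_mul_I, ← Complex.ofReal_sin, ← Complex.ofReal_cos, ← Complex.ofReal_sinh,
    ← Complex.ofReal_cosh, ← Complex.ofReal_mul, ← Complex.ofReal_mul, ← Complex.normSq_eq_norm_sq,
    Complex.normSq_add_mul_I, mul_pow, mul_pow, Real.cosh_sq, Real.cos_sq']
  ring

lemma abs_sinh_le_norm_sin (a b : ℝ) : |Real.sinh b| ≤ ‖Complex.sin (a + b * Complex.I)‖ := by
  refine abs_le_of_sq_le_sq ?_ (norm_nonneg _)
  rw [norm_sin_sq]
  linarith [sq_nonneg (Real.sin a)]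

lemma abs_sin_le_norm_sin (a b : ℝ) : |Real.sin a| ≤ ‖Complex.sin (a + b * Complex.I)‖ := by
  refine abs_le_of_sq_le_sq ?_ (norm_nonneg _)
  rw [norm_sin_sq]
  linarith [sq_nonneg (Real.sinh b)]

/-- The integrand whose contour integral represents the error of the Sinc interpolation at `x`. -/
noncomputable def sincKernel (F : ℂ → ℂ) (h x : ℝ) (ζ : ℂ) : ℂ :=
  F ζ * Real.sin (Real.pi * x / h) / ((ζ - x) * Complex.sin (Real.pi * ζ / h))

lemma isOpen_abs_re_lt_abs_im_lt (A d : ℝ) : IsOpen {z : ℂ | |z.re| < A ∧ |z.im| < d} :=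
  (isOpen_lt (f := fun z : ℂ => |z.re|) (by fun_prop) continuous_const).inter
    (isOpen_lt (f := fun z : ℂ => |z.im|) (by fun_prop) continuous_const)

/-- The quotient is the reciprocal of the slope of sin(πz/h) at a simple zero, where the derivative
is (-1)^k π/h. -/
lemma tendsto_sub_div_sin_node {h : ℝ} (hh : 0 < h) (k : ℤ) :
    Tendsto (fun z : ℂ => (z - ((k * h : ℝ) : ℂ)) / Complex.sin (Real.pi * z / h))
      (𝓝[≠] ((k * h : ℝ) : ℂ)) (𝓝 ((((-1 : ℝ) ^ k * (h / Real.pi) : ℝ) : ℂ))) := by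
  have hh' : (h : ℂ) ≠ 0 := by exact_mod_cast hh.ne'
  have harg : (Real.pi : ℂ) * ((k * h : ℝ) : ℂ) / h = k * Real.pi := by
    push_cast; field_simp
  have h1 : HasDerivAt (fun z : ℂ => (Real.pi : ℂ) * z / h) (Real.pi / h) ((k * h : ℝ) : ℂ) := by
    simpa using ((hasDerivAt_id ((k * h : ℝ) : ℂ)).const_mul (Real.pi : ℂ)).div_const (h : ℂ)
  have h2 := h1.csin.tendsto_slope
  rw [harg] at h2
  have hcos : Complex.cos (k * Real.pi) = (((-1 : ℝ) ^ k : ℝ) : ℂ) := by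
    rw [← Real.cos_int_mul_pi]; push_cast; rfl
  have hne : ((-1 : ℝ) ^ k) ≠ 0 := zpow_ne_zero _ (by norm_num)
  have hval : Complex.cos (k * Real.pi) * (Real.pi / h) =
      (((-1 : ℝ) ^ k * (Real.pi / h) : ℝ) : ℂ) := by rw [hcos]; push_cast; rfl
  rw [hval] at h2
  have h3 := h2.inv₀ (by
    exact_mod_cast mul_ne_zero hne (div_ne_zero Real.pi_ne_zero hh.ne'))
  have hlim : ((((-1 : ℝ) ^ k * (Real.pi / h) : ℝ) : ℂ))⁻¹ =
      (((-1 : ℝ) ^ k * (h / Real.pi) : ℝ) : ℂ) := by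
    rw [← Complex.ofReal_inv, mul_inv, inv_div, ← inv_zpow, inv_neg, inv_one]
  rw [hlim] at h3
  refine h3.congr fun z => ?_
  rw [slope_def_field, harg, Complex.sin_int_mul_pi, sub_zero, inv_div]

/-- The interpolation error as a contour integral. -/
lemma rectIntegral_sincKernel {F : ℂ → ℂ} {d e h x : ℝ} (hF : AnalyticOnNhd ℂ F (strip d))
    (he : 0 < e) (hed : e < d) (hh : 0 < h) (hx : Real.sin (Real.pi * x / h) ≠ 0) {K : ℤ}
    (hK : |x| < (K + 1 / 2) * h) :
    rectIntegral (sincKernel F h x) (-((K + 1 / 2) * h)) ((K + 1 / 2) * h) e =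
      2 * Real.pi * Complex.I * (F x - sincApprox F h K K x) := by
  have hp := Real.pi_pos
  have hh' : (h : ℂ) ≠ 0 := by exact_mod_cast hh.ne'
  -- The vertical edges run midway between nodes, where |sin(π Re ζ / h)| = 1.
  set A := (K + 1 / 2) * h with hA
  have hA0 : 0 < A := (abs_nonneg x).trans_lt hK
  have hnode : ∀ k : ℤ, (k : ℝ) * h ≠ x := by
    rintro k rfl
    apply hx
    rw [show Real.pi * (k * h) / h = k * Real.pi by field_simp]
    exact Real.sin_int_mul_pi k
  -- An open neighbourhood of the rectangle that still stops short of the nodes ±(K+1)h.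
  set U : Set ℂ := {z | |z.re| < (K + 1) * h ∧ |z.im| < d} with hU
  set S : Finset ℝ := insert x ((Finset.Icc (-K) K).image fun k : ℤ => (k : ℝ) * h) with hS
  set r : ℝ → ℂ := fun c => if c = x then F x else -(F c * (nsinc ((x - c) / h) : ℝ)) with hr
  have hFd : ∀ z : ℂ, |z.im| < d → DifferentiableAt ℂ F z := fun z hz =>
    (hF z hz).differentiableAt
  have hsin0 : ∀ z ∈ U, (∀ k ∈ Finset.Icc (-K) K, z ≠ ((k * h : ℝ) : ℂ)) →
      Complex.sin (Real.pi * z / h) ≠ 0 := by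
    intro z hz hzk h0
    obtain ⟨k, hk⟩ := Complex.sin_eq_zero_iff.1 h0
    have hpc : (Real.pi : ℂ) ≠ 0 := by exact_mod_cast hp.ne'
    have hzk' : z = ((k * h : ℝ) : ℂ) := by
      push_cast
      field_simp at hk
      linear_combination hk
    refine hzk k ?_ hzk'
    have h1 := hz.1
    rw [hzk', Complex.ofReal_re, abs_mul, abs_of_pos hh] at h1
    have h2 : |(k : ℝ)| < K + 1 := lt_of_mul_lt_mul_right h1 hh.le
    have h3 : |k| < K + 1 := by exact_mod_cast h2
    rw [Finset.mem_Icc]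
    rw [abs_lt] at h3
    omega
  have hkS : ∀ k ∈ Finset.Icc (-K) K, |(k : ℝ) * h| < A := by
    intro k hk
    rw [Finset.mem_Icc] at hk
    rw [abs_mul, abs_of_pos hh, hA]
    have : |k| ≤ K := abs_le.2 hk
    have : |(k : ℝ)| ≤ K := by exact_mod_cast this
    gcongr
    linarith
  have hres := rectIntegral_eq_sum_residues (a := -A) (b := A) (by linarith) he
    (isOpen_abs_re_lt_abs_im_lt ((K + 1) * h) d) (r := r) (S := S) (f := sincKernel F h x)
    ?_ ?_ ?_ ?_
  · rw [hres, hS, Finset.sum_insert, Finset.sum_image]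
    · congr 1
      simp only [hr, if_true, hnode, if_false, Finset.sum_neg_distrib, sincApprox]
      rw [← sub_eq_add_neg]
    · intro i _ j _ hij
      exact_mod_cast mul_right_cancel₀ hh.ne' hij
    · simp only [Finset.mem_image, not_exists, not_and]
      exact fun k _ => hnode k
  · rintro z ⟨hz1, hz2⟩
    refine ⟨(abs_le.2 hz1).trans_lt ?_, (abs_le.2 hz2).trans_lt hed⟩
    rw [hA]; gcongr; norm_num
  · intro c hc
    rw [hS, Finset.mem_insert, Finset.mem_image] at hc
    rcases hc with rfl | ⟨k, hk, rfl⟩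
    · exact abs_lt.1 hK
    · exact abs_lt.1 (hkS k hk)
  · intro z hz hzS
    have hzx : z - x ≠ 0 := sub_ne_zero.2 (hzS x (Finset.mem_insert_self _ _))
    have hs := hsin0 z hz fun k hk => hzS _
      (Finset.mem_insert_of_mem (Finset.mem_image_of_mem _ hk))
    refine ((hFd z hz.2).mul_const _).div ?_ (mul_ne_zero hzx hs)
    fun_prop
  · intro c hc
    rw [hS, Finset.mem_insert, Finset.mem_image] at hc
    rcases hc with rfl | ⟨k, hk, rfl⟩
    · have hsc : Complex.sin (Real.pi * (c : ℂ) / h) = (Real.sin (Real.pi * c / h) : ℝ) := by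
        push_cast; rfl
      have hsc0 : Complex.sin (Real.pi * (c : ℂ) / h) ≠ 0 := by
        rw [hsc]; exact_mod_cast hx
      have hcont : ContinuousAt (fun z => F z * (Real.sin (Real.pi * c / h) : ℝ) /
          Complex.sin (Real.pi * z / h)) (c : ℂ) := by
        refine ContinuousAt.div ((hFd c (by simpa using he.trans hed)).continuousAt.mul
          continuousAt_const) (Continuous.continuousAt (by fun_prop)) hsc0
      have h1 := hcont.tendsto.mono_left (nhdsWithin_le_nhds (s := {(c : ℂ)}ᶜ))
      have h2 : F c * (Real.sin (Real.pi * c / h) : ℝ) / Complex.sin (Real.pi * c / h) = r c := by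
        rw [hr, ← hsc]; simp only [if_true]; field_simp
      rw [h2] at h1
      refine h1.congr' ?_
      filter_upwards [self_mem_nhdsWithin] with z hz
      have hz0 : z - c ≠ 0 := sub_ne_zero.2 hz
      rw [sincKernel, ← mul_div_assoc, mul_div_mul_left _ _ hz0]
    · have hne : (((k * h : ℝ) : ℂ) - x) ≠ 0 := by
        rw [sub_ne_zero]; exact_mod_cast hnode k
      have hcont : ContinuousAt (fun z => F z * (Real.sin (Real.pi * x / h) : ℝ) / (z - x))
          ((k * h : ℝ) : ℂ) := by
        refine ContinuousAt.div ((hFd _ (by simpa using he.trans hed)).continuousAt.mul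
          continuousAt_const) (Continuous.continuousAt (by fun_prop)) hne
      have h1 := (hcont.tendsto.mono_left (nhdsWithin_le_nhds (s := {((k * h : ℝ) : ℂ)}ᶜ))).mul
        (tendsto_sub_div_sin_node hh k)
      have hxk : x - k * h ≠ 0 := sub_ne_zero.2 (hnode k).symm
      -- Shifting by k periods of length π gives sin(π(x - kh)/h) = (-1)^k sin(πx/h), so the residue
      -- at a node is a sinc term.
      have hns : nsinc ((x - k * h) / h) =
          (-1) ^ k * Real.sin (Real.pi * x / h) / (Real.pi * ((x - k * h) / h)) := by
        rw [nsinc, Real.sinc_of_ne_zero (by positivity), ← Real.sin_sub_int_mul_pi]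
        congr 2
        field_simp
      have h2 : F ((k * h : ℝ) : ℂ) * (Real.sin (Real.pi * x / h) : ℝ) / (((k * h : ℝ) : ℂ) - x) *
          (((-1 : ℝ) ^ k * (h / Real.pi) : ℝ) : ℂ) = r (k * h) := by
        simp only [hr, hnode, if_false]
        rw [mul_div_assoc, mul_assoc, ← mul_neg, ← Complex.ofReal_neg, hns, ← Complex.ofReal_sub,
          ← Complex.ofReal_div, ← Complex.ofReal_mul]
        congr 2
        have : k * h - x ≠ 0 := sub_ne_zero.2 (hnode k)
        rw [show x - k * h = -(k * h - x) by ring]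
        field_simp
      rw [h2] at h1
      refine h1.congr' ?_
      filter_upwards with z
      rw [sincKernel, div_mul_div_comm, mul_comm (F z * _), mul_div_assoc]

end DESinc

/-! ### Discretization error: the limits K → ∞ and e → d. -/

namespace DESinc

open Set Filter Topology

/-- The norm of the interpolation error at a point that is not a node. -/
lemma norm_sub_sincApprox_le_of_sin_ne_zero {F : ℂ → ℂ} {d e h x B c : ℝ}
    (hF : AnalyticOnNhd ℂ F (strip d)) (hB : 0 ≤ B) (hc : 0 < c)
    (hFb : ∀ ζ ∈ strip d, ‖F ζ‖ ≤ B * Real.exp (-(c * |Real.sinh ζ.re|)))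
    (he : 0 < e) (hed : e < d) (hh : 0 < h) (hx : Real.sin (Real.pi * x / h) ≠ 0) {K : ℤ}
    (hK : |x| < (K + 1 / 2) * h) :
    ‖F x - sincApprox F h K K x‖ ≤
      (4 * (B / (e * Real.sinh (Real.pi * e / h))) / c +
        4 * e * (B / ((K + 1 / 2) * h - |x|))) / (2 * Real.pi) := by
  have hp := Real.pi_pos
  have hsh : 0 < Real.sinh (Real.pi * e / h) := Real.sinh_pos_iff.2 (by positivity)
  have hA0 : 0 < (K + 1 / 2) * h := (abs_nonneg x).trans_lt hK
  have hint := rectIntegral_sincKernel hF he hed hh hx hK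
  have hnorm : ‖rectIntegral (sincKernel F h x) (-((K + 1 / 2) * h)) ((K + 1 / 2) * h) e‖ =
      2 * Real.pi * ‖F x - sincApprox F h K K x‖ := by
    rw [hint]; simp [abs_of_pos hp]
  rw [le_div_iff₀' (by positivity), ← hnorm]
  have harg : ∀ t y : ℝ, (Real.pi : ℂ) * (t + (y : ℂ) * Complex.I) / h =
      ((Real.pi * t / h : ℝ) : ℂ) + ((Real.pi * y / h : ℝ) : ℂ) * Complex.I := by
    intro t y; push_cast; ring
  have hker : ∀ t y p q : ℝ, |y| < d → 0 < p → 0 < q →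
      p ≤ ‖(t : ℂ) + (y : ℂ) * Complex.I - x‖ →
      q ≤ ‖Complex.sin (Real.pi * (t + (y : ℂ) * Complex.I) / h)‖ →
      ‖sincKernel F h x (t + (y : ℂ) * Complex.I)‖ ≤
        B / (p * q) * Real.exp (-(c * |Real.sinh t|)) := by
    intro t y p q hy hp0 hq0 hpn hqn
    rw [sincKernel, norm_div, norm_mul, norm_mul, Complex.norm_real, Real.norm_eq_abs,
      div_mul_eq_mul_div]
    have h1 := hFb (t + (y : ℂ) * Complex.I) (by simpa [strip] using hy)
    rw [Complex.add_re, Complex.re_ofReal_mul, Complex.I_re, mul_zero, add_zero,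
      Complex.ofReal_re] at h1
    have h2 : ‖F (t + (y : ℂ) * Complex.I)‖ * |Real.sin (Real.pi * x / h)| ≤
        B * Real.exp (-(c * |Real.sinh t|)) :=
      (mul_le_of_le_one_right (norm_nonneg _) (Real.abs_sin_le_one _)).trans h1
    gcongr
  refine norm_rectIntegral_le hA0.le he.le (by positivity) hc ?_ ?_
  · intro t _ y hy
    have hya : |y| = e := by rcases hy with rfl | rfl <;> simp [abs_of_pos he]
    -- Horizontal edges: |ζ - x| ≥ |Im ζ| = e and |sin(πζ/h)| ≥ sinh(πe/h).
    have h1 := hker t y e (Real.sinh (Real.pi * e / h)) (by rw [hya]; exact hed) he hsh ?_ ?_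
    · refine h1.trans ?_
      gcongr
      exact le_mul_of_one_le_left (Real.exp_pos _).le (Real.one_le_cosh t)
    · have := Complex.abs_im_le_norm ((t : ℂ) + (y : ℂ) * Complex.I - x)
      simpa [hya] using this
    · rw [harg]
      refine le_trans (le_of_eq ?_) (abs_sinh_le_norm_sin _ _)
      rw [Real.abs_sinh, abs_div, abs_mul, hya, abs_of_pos hp, abs_of_pos hh]
  · intro y hy t ht
    have hya : |y| ≤ e := abs_le.2 hy
    have hta : |t| = (K + 1 / 2) * h := by
      rcases ht with rfl | rfl <;> simp only [abs_neg, abs_of_pos hA0]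
    -- Vertical edges: the sine has modulus at least 1, and the distance to x grows with K, so this
    -- contribution tends to 0.
    have h1 := hker t y ((K + 1 / 2) * h - |x|) 1 (hya.trans_lt hed) (by linarith) one_pos ?_ ?_
    · refine h1.trans ?_
      rw [mul_one]
      refine mul_le_of_le_one_right (div_nonneg hB (by linarith)) (Real.exp_le_one_iff.2 ?_)
      have : 0 ≤ c * |Real.sinh t| := by positivity
      linarith
    · have h2 := Complex.abs_re_le_norm ((t : ℂ) + (y : ℂ) * Complex.I - x)
      simp only [Complex.sub_re, Complex.add_re, Complex.ofReal_re, Complex.re_ofReal_mul,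
        Complex.I_re, mul_zero, add_zero] at h2
      rw [← hta]
      exact (abs_sub_abs_le_abs_sub t x).trans h2
    · rw [harg]
      refine le_trans (le_of_eq ?_) (abs_sin_le_norm_sin _ _)
      have hs : |Real.sin (Real.pi * ((K + 1 / 2) * h) / h)| = 1 := by
        rw [show Real.pi * ((K + 1 / 2) * h) / h = K * Real.pi + Real.pi / 2 by field_simp,
          Real.sin_add_pi_div_two, Real.abs_cos_int_mul_pi]
      rcases ht with rfl | rfl
      · rw [mul_neg, neg_div, Real.sin_neg, abs_neg, hs]
      · rw [hs]

lemma sincApprox_node (F : ℂ → ℂ) {h : ℝ} (hh : 0 < h) {j K : ℤ} (hj : |j| ≤ K) :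
    sincApprox F h K K (j * h) = F ((j * h : ℝ) : ℂ) := by
  rw [sincApprox, Finset.sum_eq_single j]
  · simp [nsinc]
  · intro k _ hkj
    have h1 : ((j : ℝ) * h - k * h) / h = ((j - k : ℤ) : ℝ) := by push_cast; field_simp
    have h2 : nsinc ((j - k : ℤ) : ℝ) = 0 := by
      have : ((j - k : ℤ) : ℝ) ≠ 0 := by exact_mod_cast sub_ne_zero.2 hkj.symm
      rw [nsinc, Real.sinc_of_ne_zero (mul_ne_zero Real.pi_ne_zero this), mul_comm,
        Real.sin_int_mul_pi, zero_div]
    rw [h1, h2]; simp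
  · intro hn
    exact absurd (Finset.mem_Icc.2 (abs_le.1 hj)) hn

lemma tendsto_intCast_mul_sub_atTop {h : ℝ} (hh : 0 < h) (x : ℝ) :
    Tendsto (fun K : ℤ => ((K : ℝ) + 1 / 2) * h - |x|) atTop atTop :=
  tendsto_atTop_add_const_right _ _ ((tendsto_atTop_add_const_right _ _
    tendsto_intCast_atTop_atTop).atTop_mul_const hh)

/-- The discretization error, in the limit of infinitely many nodes, up to a perturbation `T`. -/
lemma norm_sub_le_of_forall_sincApprox {F : ℂ → ℂ} {d e h x B c T : ℝ} {G : ℂ}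
    (hF : AnalyticOnNhd ℂ F (strip d)) (hB : 0 ≤ B) (hc : 0 < c)
    (hFb : ∀ ζ ∈ strip d, ‖F ζ‖ ≤ B * Real.exp (-(c * |Real.sinh ζ.re|)))
    (he : 0 < e) (hed : e < d) (hh : 0 < h)
    (hG : ∀ᶠ K : ℤ in atTop, ‖sincApprox F h K K x - G‖ ≤ T) :
    ‖F x - G‖ ≤ 2 * B / (Real.pi * c * e * Real.sinh (Real.pi * e / h)) + T := by
  have hp := Real.pi_pos
  have hsh : 0 < Real.sinh (Real.pi * e / h) := Real.sinh_pos_iff.2 (by positivity)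
  have hA := tendsto_intCast_mul_sub_atTop hh x
  have hlim : Tendsto (fun K : ℤ => (4 * (B / (e * Real.sinh (Real.pi * e / h))) / c +
      4 * e * (B / ((K + 1 / 2) * h - |x|))) / (2 * Real.pi) + T) atTop
      (𝓝 ((4 * (B / (e * Real.sinh (Real.pi * e / h))) / c + 4 * e * 0) / (2 * Real.pi) + T)) :=
    (((hA.const_div_atTop B).const_mul (4 * e)).const_add _ |>.div_const _).add_const T
  have hval : (4 * (B / (e * Real.sinh (Real.pi * e / h))) / c + 4 * e * 0) / (2 * Real.pi) + T =
      2 * B / (Real.pi * c * e * Real.sinh (Real.pi * e / h)) + T := by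
    field_simp; ring
  rw [hval] at hlim
  refine ge_of_tendsto hlim ?_
  filter_upwards [hG, hA.eventually_gt_atTop 0, eventually_ge_atTop ⌈|x| / h⌉] with K hGK hAK hxK
  have hsplit : F x - G = (F x - sincApprox F h K K x) + (sincApprox F h K K x - G) := by ring
  rw [hsplit]
  refine norm_add_le_of_le ?_ hGK
  -- At a node the contour formula is unavailable, since x would coincide with a zero of the sine.
  -- There the sinc sum reproduces F(x) exactly once K ≥ |x|/h.
  by_cases hx : Real.sin (Real.pi * x / h) = 0
  · obtain ⟨j, hj⟩ := Real.sin_eq_zero_iff.1 hx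
    have hxj : x = j * h := by field_simp at hj; linarith
    have hjK : |j| ≤ K := by
      rw [hxj, abs_mul, abs_of_pos hh, mul_div_assoc, div_self hh.ne', mul_one] at hxK
      rw [← Int.cast_abs, Int.ceil_intCast] at hxK
      exact hxK
    rw [hxj, sincApprox_node F hh hjK, sub_self, norm_zero, ← hxj]
    positivity
  · exact norm_sub_sincApprox_le_of_sin_ne_zero hF hB hc hFb he hed hh hx (by linarith)

/-- F is controlled only in the open strip, so the contour stays at height e < d; the resulting
bound is continuous in e, which permits e → d. -/
lemma norm_sub_le_of_forall_sincApprox_limit {F : ℂ → ℂ} {d h x B c T : ℝ} {G : ℂ}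
    (hF : AnalyticOnNhd ℂ F (strip d)) (hB : 0 ≤ B) (hc : 0 < c)
    (hFb : ∀ ζ ∈ strip d, ‖F ζ‖ ≤ B * Real.exp (-(c * |Real.sinh ζ.re|)))
    (hd : 0 < d) (hh : 0 < h) (hG : ∀ᶠ K : ℤ in atTop, ‖sincApprox F h K K x - G‖ ≤ T) :
    ‖F x - G‖ ≤ 2 * B / (Real.pi * c * d * Real.sinh (Real.pi * d / h)) + T := by
  have hp := Real.pi_pos
  have hsh : 0 < Real.sinh (Real.pi * d / h) := Real.sinh_pos_iff.2 (by positivity)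
  have hcont : ContinuousAt
      (fun e => 2 * B / (Real.pi * c * e * Real.sinh (Real.pi * e / h)) + T) d := by
    have hsn := Real.continuous_sinh
    exact (continuousAt_const.div (Continuous.continuousAt (by fun_prop)) (by positivity)).add
      continuousAt_const
  refine ge_of_tendsto (hcont.tendsto.mono_left (nhdsWithin_le_nhds (s := Iio d))) ?_
  filter_upwards [Ioo_mem_nhdsLT hd] with e he
  exact norm_sub_le_of_forall_sincApprox hF hB hc hFb he.1 he.2 hh hG

/-- As n ≥ 1, exp(-2πdn) ≤ exp(-2πd). This replaces an n-dependent factor by the constant 1 -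
exp(-2πd) in C. -/
lemma exp_mul_le_two_mul_sinh {d : ℝ} (hd : 0 ≤ d) {n : ℕ} (hn : 0 < n) :
    Real.exp (Real.pi * d * n) * (1 - Real.exp (-(2 * Real.pi * d))) ≤
      2 * Real.sinh (Real.pi * d * n) := by
  have hp := Real.pi_pos
  have h1 : (1 : ℝ) ≤ n := by exact_mod_cast hn
  have h2 : Real.exp (-(Real.pi * d * n)) ≤
      Real.exp (Real.pi * d * n) * Real.exp (-(2 * Real.pi * d)) := by
    rw [← Real.exp_add, Real.exp_le_exp]
    have : Real.pi * d * 1 ≤ Real.pi * d * n := by gcongr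
    linarith
  rw [Real.sinh_eq]
  linarith

end DESinc

/-- Boundedness is part of the conclusion because a real supremum over an unbounded set defaults to
0, which would make the estimate alone meaningless. -/
theorem corollary1 (L R α β d : ℝ) (hL : 0 < L) (hR : 0 < R) (hα : 0 < α) (hβ : 0 < β)
    (hd : 0 < d) (hd' : d < Real.pi / 2)
    (F : ℂ → ℂ) (hF : DESinc.MemLDE L R α β d F)
    (μ : ℝ) (hμ : μ = min α β)
    (C : ℝ)
    (hC : C = 2 / (Real.pi * d) *
      (2 * L / (Real.pi * μ * (1 - Real.exp (-(2 * Real.pi * d)))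
          * Real.cos (Real.pi / 2 * Real.sin d) ^ (α + β) * Real.cos d)
        + R))
    (n : ℕ) (hn : 0 < n)
    (h : ℝ) (hh : h = 1 / (n : ℝ))
    (M N : ℤ)
    (hM : M = ⌈1 / h * Real.arsinh (d * n / α)⌉)
    (hN : N = ⌈1 / h * Real.arsinh (d * n / β)⌉) :
    BddAbove (Set.range fun x : ℝ => ‖F (x : ℂ) - DESinc.sincApprox F h M N x‖) ∧
      (⨆ x : ℝ, ‖F (x : ℂ) - DESinc.sincApprox F h M N x‖)
        ≤ C * Real.exp (-(Real.pi * d * n)) := by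
  have hp := Real.pi_pos
  have hnR : (0 : ℝ) < n := by exact_mod_cast hn
  have hh0 : 0 < h := by rw [hh]; positivity
  have hnh : (n : ℝ) = 1 / h := by rw [hh, one_div_one_div]
  have hμ0 : 0 < μ := hμ ▸ lt_min hα hβ
  have hcd : 0 < Real.cos d := Real.cos_pos_of_mem_Ioo ⟨by linarith, hd'⟩
  have hsd : Real.sin d < 1 := by
    rw [← Real.sin_pi_div_two]
    exact Real.sin_lt_sin_of_lt_of_le_pi_div_two (by linarith) le_rfl hd'
  have hsd0 : 0 ≤ Real.sin d := Real.sin_nonneg_of_nonneg_of_le_pi hd.le (by linarith)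
  have hk : 0 < Real.cos (Real.pi / 2 * Real.sin d) :=
    Real.cos_pos_of_mem_Ioo ⟨by nlinarith, by nlinarith⟩
  have hE : 0 < 1 - Real.exp (-(2 * Real.pi * d)) :=
    by
    rw [sub_pos, ← Real.exp_zero, Real.exp_lt_exp, neg_neg_iff_pos]; positivity
  have hS : 0 < Real.sinh (Real.pi * d * n) := Real.sinh_pos_iff.2 (by positivity)
  set κ := Real.cos (Real.pi / 2 * Real.sin d) ^ (α + β) with hκ
  have hκ0 : 0 < κ := Real.rpow_pos_of_pos hk _
  have main : ∀ x : ℝ, ‖F (x : ℂ) - DESinc.sincApprox F h M N x‖ ≤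
      C * Real.exp (-(Real.pi * d * n)) := by
    intro x
    have htail : ∀ᶠ K : ℤ in Filter.atTop,
        ‖DESinc.sincApprox F h K K x - DESinc.sincApprox F h M N x‖ ≤
          2 * R * Real.exp (-(Real.pi * d * n)) / (Real.pi * d) := by
      filter_upwards [Filter.eventually_ge_atTop M, Filter.eventually_ge_atTop N] with K hMK hNK
      rw [hnh] at hM hN ⊢
      exact hF.norm_sincApprox_sub_le hR hα hβ hd hh0 hM hN hMK hNK x
    -- The perturbation is the truncation error: the full symmetric sum is compared with the sum
    -- from -M to N for all large K.
    have h1 := DESinc.norm_sub_le_of_forall_sincApprox_limit (B := L / κ)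
      (c := Real.pi * μ * Real.cos d) hF.analytic (by positivity) (by positivity)
      (fun ζ hζ => by
        rw [hμ]; exact hF.norm_le_exp hL hα hβ hd' hζ) hd hh0 htail
    refine h1.trans ?_
    rw [show Real.pi * d / h = Real.pi * d * n by rw [hnh]; ring]
    have h2 : 1 / Real.sinh (Real.pi * d * n) ≤
        2 * Real.exp (-(Real.pi * d * n)) / (1 - Real.exp (-(2 * Real.pi * d))) := by
      rw [div_le_div_iff₀ hS hE, Real.exp_neg (Real.pi * d * n)]
      have h3 := DESinc.exp_mul_le_two_mul_sinh hd.le hn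
      have h4 := mul_le_mul_of_nonneg_left h3 (inv_nonneg.2 (Real.exp_pos (Real.pi * d * n)).le)
      rw [inv_mul_cancel_left₀ (Real.exp_pos _).ne'] at h4
      linarith
    calc _ = 2 * (L / κ) / (Real.pi * (Real.pi * μ * Real.cos d) * d) *
            (1 / Real.sinh (Real.pi * d * n)) +
            2 * R * Real.exp (-(Real.pi * d * n)) / (Real.pi * d) := by
          field_simp
      _ ≤ 2 * (L / κ) / (Real.pi * (Real.pi * μ * Real.cos d) * d) *
            (2 * Real.exp (-(Real.pi * d * n)) / (1 - Real.exp (-(2 * Real.pi * d)))) +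
            2 * R * Real.exp (-(Real.pi * d * n)) / (Real.pi * d) := by gcongr
      _ = _ := by
          rw [hC]
          field_simp
  refine ⟨⟨_, Set.forall_mem_range.2 main⟩, ciSup_le main⟩
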